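/- Let $\Gamma$ be a finitely generated virtually nilpotent group (i.e. $\Gamma$ has a nilpotent subgroup of finite index), and let $S\subseteq\Gamma$ be a finite symmetric ($S^{-1}=S$) generating set containing the identity $e$. For an integer $n\ge 0$ let $S^n$ be the set of products of exactly $n$ elements of $S$ (with $S^0=\{e\}$), let $\ell_S(g)=\min\{n\ge 0: g\in S^n\}$ be the word length, and let $B_S(n)=\{g\in\Gamma:\ell_S(g)\le n\}$ be the word ball of radius $n$. Fix real numbers $R_0\ge 1$ and $0<\theta\le 1$. Then there exist positive integers $L=L(\Gamma,S,R_0,\theta)$ and $h_0=h_0(\Gamma,S,R_0,\theta)$ such that, for every integer $h\ge h_0$, there is a set $Y_h\subseteq\Gamma$ with $|Y_h|\le L$ and \[ B_S(\lfloor R_0h\rfloor)\subseteq Y_h\,B_S(\lfloor\theta h\rfloor); \] equivalently, $S^{\lfloor R_0h\rfloor}\subseteq Y_h\,S^{\lfloor\theta h\rfloor}$. -/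

import Mathlib

open scoped Pointwise

/-- The word length `min {n ≥ 0 : g ∈ S ^ n}`, where `S ^ n` is the set of products of exactly `n`
elements of `S` (so `S ^ 0 = {1}`). It takes values in `ℕ∞`, being `⊤` when `g` lies in no power
of `S`; it is finite everywhere if `S` is a symmetric generating set. -/
noncomputable def wordLength {Γ : Type*} [Group Γ] (S : Set Γ) (g : Γ) : ℕ∞ :=
  sInf {k : ℕ∞ | ∃ n : ℕ, k = n ∧ g ∈ S ^ n}

/-- The word ball `B_S(n)` of radius `n` about the identity. -/
def wordBall {Γ : Type*} [Group Γ] (S : Set Γ) (n : ℕ) : Set Γ :=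
  {g : Γ | wordLength S g ≤ n}

/-! ### Lower central series and generators adapted to it. -/

section LowerCentralSeries

variable {G : Type*} [Group G]

open scoped commutatorElement

local notation "γ" => Subgroup.lowerCentralSeries (⊤ : Subgroup G)

/-! The key is to cover `S ^ (R * m)` by boundedly many translates of `S ^ (D * m)` with `D`
independent of `R`. Once `D` is known, `m` is taken of order `θ * h / (D + 1)`, and `R` large in
terms of `D`, `R₀`, `θ`.

In the nilpotent case, choose generators `t i` refining the lower central series and remove one
coordinate at a time (`exists_cover_tail`). Put `w = u i + 1`. An element of length `O(m)` in the
`i`-th tail has `t i`-exponent `e = O(m ^ w)` (`exists_zpow_of_mem_pow`), while powers of `t i` up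
to `m ^ w` are represented, modulo the next tail, in length `O(m)` (`exists_mem_pow_zpow`). Divide
`e` by `m ^ w`: the quotient takes boundedly many values and goes into the translate, the remainder
goes into the error. Only the number of quotients depends on `R`.

The virtually nilpotent case follows by Schreier rewriting into a nilpotent subgroup of finite
index. -/

/-- The three subgroups lemma modulo a normal subgroup. -/
theorem commutator_commutator_le_of_rotate {H₁ H₂ H₃ K : Subgroup G} [K.Normal]
    (h₁ : ⁅⁅H₂, H₃⁆, H₁⁆ ≤ K) (h₂ : ⁅⁅H₃, H₁⁆, H₂⁆ ≤ K) : ⁅⁅H₁, H₂⁆, H₃⁆ ≤ K := by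
  rw [← QuotientGroup.ker_mk' K, ← Subgroup.map_eq_bot_iff] at h₁ h₂ ⊢
  simp only [Subgroup.map_commutator] at h₁ h₂ ⊢
  exact Subgroup.commutator_commutator_eq_bot_of_rotate h₁ h₂

/-- A subgroup squeezed between consecutive terms of the lower central series is normal. -/
theorem normal_of_lowerCentralSeries_le {K : Subgroup G} {k : ℕ} (h₁ : γ (k + 1) ≤ K)
    (h₂ : K ≤ γ k) : K.Normal := by
  rw [← Subgroup.commutator_top_right_le_iff]
  exact (Subgroup.commutator_mono h₂ le_rfl).trans h₁

/-- Three subgroups lemma, by induction on `b` for all `a` at once. The extra `1` comes from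
indexing the series from `0`. -/
theorem commutator_lowerCentralSeries_le (a b : ℕ) : ⁅γ a, γ b⁆ ≤ γ (a + b + 1) := by
  induction b generalizing a with
  | zero => exact le_rfl
  | succ b ih =>
    rw [Subgroup.commutator_comm, Subgroup.lowerCentralSeries_succ]
    apply commutator_commutator_le_of_rotate
    · rw [Subgroup.commutator_comm ⊤, ← Subgroup.lowerCentralSeries_succ]
      refine (ih (a + 1)).trans (le_of_eq ?_)
      congr 1; omega
    · exact Subgroup.commutator_mono (ih a) le_rfl

theorem commutatorElement_mem_iff_commute {K : Subgroup G} [K.Normal] {x g : G} :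
    ⁅x, g⁆ ∈ K ↔ Commute (x : G ⧸ K) (g : G ⧸ K) := by
  rw [← commutatorElement_eq_one_iff_commute, ← QuotientGroup.eq_one_iff]
  exact Iff.rfl

/-- If generators of `H` commute modulo `K` with generators of the whole group, then
`⁅H, ⊤⁆ ≤ K`. -/
theorem commutator_top_le_of_closure {H K : Subgroup G} [K.Normal] {T S : Set G}
    (hH : H ≤ Subgroup.closure T) (hS : Subgroup.closure S = ⊤)
    (h : ∀ x ∈ T, ∀ s ∈ S, ⁅x, s⁆ ∈ K) : ⁅H, ⊤⁆ ≤ K := by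
  have hmap : ∀ (A : Set G), (Subgroup.closure A).map (QuotientGroup.mk' K) =
      Subgroup.closure (QuotientGroup.mk' K '' A) := fun A => MonoidHom.map_closure _ A
  rw [← hS]
  refine (Subgroup.commutator_mono hH le_rfl).trans ?_
  rw [← QuotientGroup.ker_mk' K, ← Subgroup.map_eq_bot_iff, Subgroup.map_commutator, hmap, hmap,
    Subgroup.commutator_eq_bot_iff_le_centralizer, Subgroup.centralizer_closure,
    Subgroup.closure_le]
  rintro _ ⟨x, hx, rfl⟩
  rw [SetLike.mem_coe, Subgroup.mem_centralizer_iff]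
  rintro _ ⟨s, hs, rfl⟩
  exact (commutatorElement_mem_iff_commute.1 (h x hx s hs)).eq.symm

/-- The successive quotients of the lower central series of a finitely generated group are finitely
generated. -/
theorem exists_finite_lowerCentralSeries_le [Group.FG G] (k : ℕ) :
    ∃ T : Set G, T.Finite ∧ T ⊆ γ k ∧ γ k ≤ Subgroup.closure T ⊔ γ (k + 1) := by
  obtain ⟨S, hS, hSfin⟩ := (Group.fg_iff (G := G)).1 inferInstance
  induction k with
  | zero => exact ⟨S, hSfin, by simp, by simp [hS]⟩
  | succ k ih =>
    obtain ⟨T, hT, hTk, hle⟩ := ih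
    have hT' : Set.image2 (fun x s => ⁅x, s⁆) T S ⊆ γ (k + 1) := by
      rintro _ ⟨x, hx, s, -, rfl⟩
      exact Subgroup.commutator_mem_commutator (hTk hx) (Subgroup.mem_top s)
    refine ⟨Set.image2 (fun x s => ⁅x, s⁆) T S, hT.image2 _ hSfin, hT', ?_⟩
    -- Squeezed between consecutive terms, `K` is normal, so commutators can be tested on generators
    -- modulo `K`.
    set K := Subgroup.closure (Set.image2 (fun x s => ⁅x, s⁆) T S) ⊔ γ (k + 1 + 1) with hK
    have hKn : K.Normal := normal_of_lowerCentralSeries_le (k := k + 1) le_sup_right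
      (sup_le ((Subgroup.closure_le _).2 hT') (Subgroup.lowerCentralSeries_antitone _ (Nat.le_succ _)))
    have hle' : γ k ≤ Subgroup.closure (T ∪ γ (k + 1)) := by
      rwa [Subgroup.closure_union, Subgroup.closure_eq]
    refine commutator_top_le_of_closure hle' hS ?_
    rintro x (hx | hx) s hs
    · exact (le_sup_left : _ ≤ K) (Subgroup.subset_closure ⟨x, hx, s, hs, rfl⟩)
    · exact (le_sup_right : _ ≤ K) (Subgroup.commutator_mem_commutator hx (Subgroup.mem_top s))

variable (G) in
/-- A finite sequence of generators `t i` of a nilpotent group that refines the lower central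
series: `t i` lies in the term of index `u i`, and each term is generated by the `t i` which it
must contain. -/
structure CentralSequence where
  /-- the generators, trivial from index `N` on -/
  t : ℕ → G
  /-- the index in the lower central series -/
  u : ℕ → ℕ
  /-- the number of generators -/
  N : ℕ
  mono : Monotone u
  t_eq_one : ∀ i, N ≤ i → t i = 1
  t_mem : ∀ i, t i ∈ γ (u i)
  le_closure : ∀ k, γ k ≤ Subgroup.closure (t '' {l | k ≤ u l})

theorem nonempty_centralSequence [Group.FG G] [Group.IsNilpotent G] :
    Nonempty (CentralSequence G) := by
  classical
  obtain ⟨c, hc⟩ := Subgroup.nilpotent_iff_lowerCentralSeries.1 ‹Group.IsNilpotent G›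
  choose T hT hTk hle using exists_finite_lowerCentralSeries_le (G := G)
  have hbot : ∀ k, c ≤ k → γ k = ⊥ := fun k hk =>
    le_bot_iff.1 (hc ▸ Subgroup.lowerCentralSeries_antitone _ hk)
  have henum : ∀ k, ∃ d, ∃ f : ℕ → G, (∀ j, f j ∈ γ k) ∧ T k ⊆ f '' {j | j < d} := by
    intro k
    obtain ⟨d, e, he⟩ := (hT k).fin_param
    refine ⟨d, fun j => if h : j < d then e ⟨j, h⟩ else 1, fun j => ?_, ?_⟩
    · by_cases h : j < d
      · simp only [h, dite_true]
        exact hTk k (he.2 ▸ Set.mem_range_self _)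
      · simp only [h, dite_false]; exact one_mem _
    · rw [← he.2]
      rintro _ ⟨j, rfl⟩
      exact ⟨j, j.2, by simp⟩
  choose d f hf hTf using henum
  -- A common block length: level `k` occupies the indices `k * D + j` with `j < D`, padded by `1`.
  -- The `+ 1` keeps `D` positive.
  set D := ∑ k ∈ Finset.range c, d k + 1 with hD
  have hdD : ∀ k < c, d k ≤ D := fun k hk =>
    (Finset.single_le_sum (f := d) (fun _ _ => Nat.zero_le _) (Finset.mem_range.2 hk)).trans
      (Nat.le_succ _)
  refine ⟨⟨fun i => f (i / D) (i % D), fun i => i / D, c * D, ?_, ?_, fun i => hf _ _, ?_⟩⟩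
  · exact fun i j h => Nat.div_le_div_right h
  · intro i hi
    have := hf (i / D) (i % D)
    rwa [hbot _ ((Nat.le_div_iff_mul_le (by omega)).2 hi), Subgroup.mem_bot] at this
  · suffices ∀ j k, c ≤ k + j → γ k ≤ Subgroup.closure
        ((fun i => f (i / D) (i % D)) '' {l | k ≤ l / D}) from fun k => this c k (by omega)
    intro j
    induction j with
    | zero => intro k hk; rw [hbot k hk]; exact bot_le
    | succ j ih =>
      intro k hk
      rcases le_or_gt c k with hck | hck
      · rw [hbot k hck]; exact bot_le
      refine (hle k).trans (sup_le ((Subgroup.closure_le _).2 ?_) ?_)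
      · intro x hx
        obtain ⟨i, hi, rfl⟩ := hTf k hx
        have hiD : i < D := lt_of_lt_of_le hi (hdD k hck)
        have h1 : (k * D + i) / D = k := by
          rw [mul_comm, Nat.mul_add_div (by omega), Nat.div_eq_of_lt hiD, add_zero]
        have h2 : (k * D + i) % D = i := by
          rw [mul_comm, Nat.mul_add_mod, Nat.mod_eq_of_lt hiD]
        exact Subgroup.subset_closure ⟨k * D + i, by simp [h1], by simp [h1, h2]⟩
      · exact (ih (k + 1) (by omega)).trans
          (Subgroup.closure_mono (Set.image_mono fun l (hl : k + 1 ≤ l / D) => (Nat.le_succ k).trans hl))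

namespace CentralSequence

variable (σ : CentralSequence G)

/-- The subgroup generated by the terms of a central sequence from index `i` on. -/
def tail (i : ℕ) : Subgroup G := Subgroup.closure (σ.t '' Set.Ici i)

theorem tail_zero : σ.tail 0 = ⊤ := by
  refine top_le_iff.1 ((σ.le_closure 0).trans (Subgroup.closure_mono (Set.image_mono ?_)))
  exact fun l _ => Nat.zero_le l

theorem tail_N : σ.tail σ.N = ⊥ := by
  rw [tail, Subgroup.closure_eq_bot_iff]
  rintro _ ⟨i, hi, rfl⟩
  exact σ.t_eq_one i hi

theorem tail_anti : Antitone σ.tail := fun _ _ h =>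
  Subgroup.closure_mono (Set.image_mono (Set.Ici_subset_Ici.2 h))

theorem t_mem_tail (i : ℕ) : σ.t i ∈ σ.tail i :=
  Subgroup.subset_closure ⟨i, Set.mem_Ici.2 le_rfl, rfl⟩

theorem tail_le (i : ℕ) : σ.tail i ≤ γ (σ.u i) := by
  refine (Subgroup.closure_le _).2 ?_
  rintro _ ⟨l, hl, rfl⟩
  exact Subgroup.lowerCentralSeries_antitone _ (σ.mono hl) (σ.t_mem l)

theorem lt_of_u_lt {i l : ℕ} (h : σ.u i < σ.u l) : i < l :=
  not_le.1 fun h' => (σ.mono h').not_gt h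

/-- Generators of strictly larger index come later in the sequence. This makes `t i` central modulo
the next tail. -/
theorem lowerCentralSeries_le_tail (i : ℕ) : γ (σ.u i + 1) ≤ σ.tail (i + 1) :=
  (σ.le_closure _).trans (Subgroup.closure_mono (Set.image_mono fun _ hl => σ.lt_of_u_lt hl))

instance normal_tail_succ (i : ℕ) : (σ.tail (i + 1)).Normal :=
  normal_of_lowerCentralSeries_le (σ.lowerCentralSeries_le_tail i)
    ((σ.tail_anti (Nat.le_succ i)).trans (σ.tail_le i))

end CentralSequence

end LowerCentralSeries

/-! ### Elementary length estimates. -/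

section WordPowers

variable {G : Type*} [Group G] {S : Set G}

theorem mul_mem_pow_add {a b : ℕ} {g h : G} (hg : g ∈ S ^ a) (hh : h ∈ S ^ b) :
    g * h ∈ S ^ (a + b) := by
  rw [pow_add]; exact Set.mul_mem_mul hg hh

theorem inv_mem_pow (hsymm : S⁻¹ = S) {a : ℕ} {g : G} (hg : g ∈ S ^ a) : g⁻¹ ∈ S ^ a := by
  have h : (S ^ a)⁻¹ = S ^ a := by rw [← inv_pow, hsymm]
  rw [← h]; simpa using hg

theorem mem_pow_of_le (hone : (1 : G) ∈ S) {a b : ℕ} (hab : a ≤ b) {g : G} (hg : g ∈ S ^ a) :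
    g ∈ S ^ b :=
  Set.pow_subset_pow_right hone hab hg

theorem zpow_mem_pow (hone : (1 : G) ∈ S) (hsymm : S⁻¹ = S) {a M : ℕ} {g : G} (hg : g ∈ S ^ a)
    {r : ℤ} (hr : |r| ≤ M) : g ^ r ∈ S ^ (a * M) := by
  have hpow : ∀ n : ℕ, g ^ n ∈ S ^ (a * n) := fun n => by
    rw [pow_mul]; exact Set.pow_mem_pow hg
  have hr' : r.natAbs ≤ M := by rwa [Int.abs_eq_natAbs, Int.ofNat_le] at hr
  refine mem_pow_of_le hone (Nat.mul_le_mul_left a hr') ?_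
  rcases Int.natAbs_eq r with h | h
  · rw [h, zpow_natCast, Int.natAbs_natCast]; exact hpow _
  · rw [h, zpow_neg, zpow_natCast, Int.natAbs_neg, Int.natAbs_natCast]
    exact inv_mem_pow hsymm (hpow _)

theorem exists_mem_pow (hsymm : S⁻¹ = S) (hgen : Subgroup.closure S = ⊤)
    (g : G) : ∃ n, g ∈ S ^ n := by
  have hg : g ∈ Subgroup.closure S := hgen ▸ Subgroup.mem_top g
  induction hg using Subgroup.closure_induction with
  | mem x hx => exact ⟨1, by simpa using hx⟩
  | one => exact ⟨0, by simp⟩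
  | mul x y _ _ hx hy =>
    obtain ⟨a, ha⟩ := hx
    obtain ⟨b, hb⟩ := hy
    exact ⟨a + b, mul_mem_pow_add ha hb⟩
  | inv x _ hx =>
    obtain ⟨a, ha⟩ := hx
    exact ⟨a, inv_mem_pow hsymm ha⟩

end WordPowers

/-! ### Short representatives of large powers. -/

section Roots

variable {G : Type*} [Group G]

open scoped commutatorElement

local notation "γ" => Subgroup.lowerCentralSeries (⊤ : Subgroup G)

theorem commutatorElement_mem_pow {S : Set G} (hsymm : S⁻¹ = S) {a b : ℕ} {g h : G}
    (hg : g ∈ S ^ a) (hh : h ∈ S ^ b) : ⁅g, h⁆ ∈ S ^ (a + b + a + b) :=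
  mul_mem_pow_add (mul_mem_pow_add (mul_mem_pow_add hg hh) (inv_mem_pow hsymm hg))
    (inv_mem_pow hsymm hh)

theorem commutatorElement_zpow_left {x g : G} (h : Commute ⁅x, g⁆ x) (a : ℤ) :
    ⁅x ^ a, g⁆ = ⁅x, g⁆ ^ a := by
  have h1 : g * x * g⁻¹ = ⁅x, g⁆⁻¹ * x := by simp [commutatorElement_def, mul_assoc]
  have h2 : g * x ^ a * g⁻¹ = (⁅x, g⁆ ^ a)⁻¹ * x ^ a := by
    rw [← conj_zpow, h1, (h.inv_left).mul_zpow, inv_zpow]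
  have h3 : ⁅x ^ a, g⁆ = x ^ a * (g * x ^ a * g⁻¹)⁻¹ := by
    simp [commutatorElement_def, mul_assoc]
  rw [h3, h2]; simp

theorem commutatorElement_zpow_zpow {x g : G} (hx : ∀ y : G, Commute ⁅x, g⁆ y) (a b : ℤ) :
    ⁅x ^ a, g ^ b⁆ = ⁅x, g⁆ ^ (a * b) := by
  have h1 : ∀ y, Commute ⁅g, x⁆ y := fun y => by
    rw [← commutatorElement_inv]; exact (hx y).inv_left
  have h2 : ⁅x, g ^ b⁆ = ⁅x, g⁆ ^ b := by
    rw [← commutatorElement_inv, commutatorElement_zpow_left (h1 g), ← commutatorElement_inv x g,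
      inv_zpow, inv_inv]
  rw [commutatorElement_zpow_left, h2, ← zpow_mul, mul_comm]
  rw [h2]; exact (hx _).zpow_left _

/-- Modulo the next term, the power `x ^ r` of an element of the lower central series term of index
`k` with `|r| ≤ m ^ (k + 1)` is represented by an element of length `O(m)`. -/
theorem exists_mem_pow_zpow {S : Set G} (hone : (1 : G) ∈ S) (hsymm : S⁻¹ = S)
    (hgen : Subgroup.closure S = ⊤) (k : ℕ) {x : G} (hx : x ∈ γ k) :
    ∃ D : ℕ, ∀ m : ℕ, 1 ≤ m → ∀ r : ℤ, |r| ≤ (m : ℤ) ^ (k + 1) →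
      ∃ b ∈ S ^ (D * m), b⁻¹ * x ^ r ∈ γ (k + 1) := by
  induction k generalizing x with
  | zero =>
    obtain ⟨D, hD⟩ := exists_mem_pow hsymm hgen x
    refine ⟨D, fun m _ r hr => ⟨x ^ r, zpow_mem_pow hone hsymm hD (by simpa using hr), ?_⟩⟩
    rw [inv_mul_cancel]; exact one_mem _
  | succ k ih =>
    have hcomm : ∀ x ∈ γ (k + 1), ∀ y : G, Commute (x : G ⧸ γ (k + 2)) (y : G ⧸ γ (k + 2)) :=
      fun x hx y => commutatorElement_mem_iff_commute.1
        (Subgroup.commutator_mem_commutator hx (Subgroup.mem_top y))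
    simp only [← QuotientGroup.eq] at ih ⊢
    rw [Subgroup.lowerCentralSeries_succ, Subgroup.commutator_def] at hx
    induction hx using Subgroup.closure_induction with
    | mem x hx =>
      obtain ⟨p, hp, g, -, rfl⟩ := hx
      obtain ⟨D, hD⟩ := ih hp
      obtain ⟨l, hl⟩ := exists_mem_pow hsymm hgen p
      obtain ⟨d, hd⟩ := exists_mem_pow hsymm hgen g
      -- Write `r = m * (r / m) + r % m`. By bilinearity `⁅p, g⁆ ^ r` is `⁅p ^ (r / m), g ^ m⁆ * ⁅p,
      -- g ^ (r % m)⁆` modulo `γ (k + 2)`, and induction shortens `p ^ (r / m)` to `b`. The constant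
      -- adds up the lengths of the two commutators.
      refine ⟨2 * D + 4 * d + 2 * l, fun m hm r hr => ?_⟩
      have hm0 : (0 : ℤ) < m := by exact_mod_cast hm
      have ha : |r / m| ≤ (m : ℤ) ^ (k + 1) := by
        rw [abs_le] at hr ⊢
        rw [pow_succ] at hr
        constructor
        · rw [Int.le_ediv_iff_mul_le hm0]; linarith [hr.1]
        · exact Int.ediv_le_of_le_mul hm0 (by linarith [hr.2])
      have hr0 := Int.emod_nonneg r hm0.ne'
      have hrm := Int.emod_lt_of_pos r hm0
      obtain ⟨b, hb, hbp⟩ := hD m hm _ ha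
      refine ⟨⁅b, g ^ (m : ℤ)⁆ * ⁅p, g ^ (r % m)⁆, ?_, ?_⟩
      · refine mem_pow_of_le hone ?_ (mul_mem_pow_add
          (commutatorElement_mem_pow hsymm hb (zpow_mem_pow hone hsymm hd (r := m) (M := m) (by simp)))
          (commutatorElement_mem_pow hsymm hl (zpow_mem_pow hone hsymm hd (r := r % m) (M := m)
            (by rw [abs_of_nonneg hr0]; exact hrm.le))))
        nlinarith [Nat.mul_le_mul_left l hm]
      · have hc : ∀ y : G ⧸ γ (k + 2), Commute ⁅(p : G ⧸ γ (k + 2)), (g : G ⧸ γ (k + 2))⁆ y := by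
          intro y
          obtain ⟨y, rfl⟩ := QuotientGroup.mk_surjective y
          exact hcomm ⁅p, g⁆ (Subgroup.commutator_mem_commutator hp (Subgroup.mem_top g)) y
        have hz : ∀ y : G, Commute ((b⁻¹ * p ^ (r / m) : G) : G ⧸ γ (k + 2)) y :=
          hcomm _ (QuotientGroup.eq.1 hbp)
        -- The discrepancy between `b` and `p ^ (r / m)` is central here, so the commutator does not
        -- see it.
        have hbz : ⁅(b : G ⧸ γ (k + 2)), ((g ^ (m : ℤ) : G) : G ⧸ γ (k + 2))⁆ =
            ⁅(p : G ⧸ γ (k + 2)) ^ (r / m), ((g ^ (m : ℤ) : G) : G ⧸ γ (k + 2))⁆ := by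
          have h1 : (p : G ⧸ γ (k + 2)) ^ (r / m) =
              (b : G ⧸ γ (k + 2)) * ((b⁻¹ * p ^ (r / m) : G) : G ⧸ γ (k + 2)) := by
            rw [← QuotientGroup.mk_mul, mul_inv_cancel_left, QuotientGroup.mk_zpow]
          rw [h1, commutatorElement_mul_left_eq_conj_mul,
            commutatorElement_eq_one_iff_commute.2 (hz _), mul_one, mul_inv_cancel, one_mul]
        have hsplit : ((⁅b, g ^ (m : ℤ)⁆ * ⁅p, g ^ (r % m)⁆ : G) : G ⧸ γ (k + 2)) =
            ⁅(b : G ⧸ γ (k + 2)), ((g ^ (m : ℤ) : G) : G ⧸ γ (k + 2))⁆ *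
            ⁅(p : G ⧸ γ (k + 2)), (g : G ⧸ γ (k + 2)) ^ (r % m)⁆ := rfl
        have hone' : ⁅(p : G ⧸ γ (k + 2)), (g : G ⧸ γ (k + 2)) ^ (r % m)⁆ =
            ⁅(p : G ⧸ γ (k + 2)), (g : G ⧸ γ (k + 2))⁆ ^ (r % m) := by
          have := commutatorElement_zpow_zpow hc 1 (r % m)
          rwa [zpow_one, one_mul] at this
        rw [hsplit, hbz, QuotientGroup.mk_zpow, commutatorElement_zpow_zpow hc, hone', ← zpow_add,
          mul_comm (r / (m : ℤ)), Int.mul_ediv_add_emod]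
        rfl
    | one =>
      exact ⟨0, fun m _ r _ => ⟨1, by simp, by simp⟩⟩
    | mul x y hx hy hx' hy' =>
      obtain ⟨D, hD⟩ := hx'
      obtain ⟨E, hE⟩ := hy'
      refine ⟨D + E, fun m hm r hr => ?_⟩
      obtain ⟨b, hb, hbx⟩ := hD m hm r hr
      obtain ⟨c, hc, hcy⟩ := hE m hm r hr
      refine ⟨b * c, ?_, ?_⟩
      · rw [add_mul]; exact mul_mem_pow_add hb hc
      · rw [QuotientGroup.mk_mul, hbx, hcy, QuotientGroup.mk_zpow, QuotientGroup.mk_zpow,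
          QuotientGroup.mk_zpow, QuotientGroup.mk_mul, (hcomm x hx y).mul_zpow]
    | inv x hx hx' =>
      obtain ⟨D, hD⟩ := hx'
      refine ⟨D, fun m hm r hr => ?_⟩
      obtain ⟨b, hb, hbx⟩ := hD m hm (-r) (by rwa [abs_neg])
      exact ⟨b, hb, by rw [hbx, inv_zpow']⟩

end Roots

/-! ### Weighted words and the distortion bound. -/

section Distortion

variable {G : Type*} [Group G]

open scoped commutatorElement

local notation "γ" => Subgroup.lowerCentralSeries (⊤ : Subgroup G)

theorem mem_closure_image_mono {ι : Type*} {t : ι → G} {A B : Set ι} {g : G}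
    (hg : g ∈ Subgroup.closure (t '' A)) (h : ∀ l ∈ A, l ∈ B) : g ∈ Subgroup.closure (t '' B) :=
  Subgroup.closure_mono (Set.image_mono h) hg

namespace CentralSequence

/-- `σ.WeightedWord q i c g` says that `g` is a product of terms `σ.t j` with `i ≤ j` and of their
inverses of total cost at most `c`, where each `σ.t j` costs `q ^ (σ.u j + 1)`. -/
inductive WeightedWord (σ : CentralSequence G) (q : ℝ) (i : ℕ) : ℝ → G → Prop
  | one (c : ℝ) : 0 ≤ c → WeightedWord σ q i c 1
  | cons (j : ℕ) (ε : ℤ) (c : ℝ) (g : G) : i ≤ j → ε = 1 ∨ ε = -1 → WeightedWord σ q i c g →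
      WeightedWord σ q i (q ^ (σ.u j + 1) + c) (σ.t j ^ ε * g)

variable {σ : CentralSequence G} {q : ℝ} {i : ℕ}

namespace WeightedWord

theorem mono {c c' : ℝ} {g : G} (h : σ.WeightedWord q i c g) (hc : c ≤ c') :
    σ.WeightedWord q i c' g := by
  induction h generalizing c' with
  | one c h => exact one c' (h.trans hc)
  | cons j ε c g hj hε _ ih =>
    have := cons (q := q) j ε (c' - q ^ (σ.u j + 1)) g hj hε (ih (by linarith))
    rwa [add_sub_cancel] at this

theorem nonneg (hq : 0 ≤ q) {c : ℝ} {g : G} (h : σ.WeightedWord q i c g) : 0 ≤ c := by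
  induction h with
  | one c h => exact h
  | cons j ε c g hj hε _ ih => positivity

theorem mul {a b : ℝ} {g h : G} (hg : σ.WeightedWord q i a g) (hh : σ.WeightedWord q i b h) :
    σ.WeightedWord q i (a + b) (g * h) := by
  induction hg with
  | one c hc => rw [one_mul]; exact hh.mono (by linarith)
  | cons j ε c g hj hε _ ih => rw [mul_assoc, add_assoc]; exact cons j ε _ _ hj hε ih

theorem single {j : ℕ} (hj : i ≤ j) {ε : ℤ} (hε : ε = 1 ∨ ε = -1) :
    σ.WeightedWord q i (q ^ (σ.u j + 1)) (σ.t j ^ ε) := by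
  simpa using cons (σ := σ) (q := q) j ε 0 1 hj hε (one 0 le_rfl)

theorem inv {c : ℝ} {g : G} (h : σ.WeightedWord q i c g) : σ.WeightedWord q i c g⁻¹ := by
  induction h with
  | one c h => rw [inv_one]; exact one c h
  | cons j ε c g hj hε _ ih =>
    rw [mul_inv_rev, ← zpow_neg, add_comm]
    exact ih.mul (single hj (by omega))

theorem pow {c : ℝ} {g : G} (h : σ.WeightedWord q i c g) (n : ℕ) :
    σ.WeightedWord q i (n * c) (g ^ n) := by
  induction n with
  | zero => rw [pow_zero]; exact one _ (by simp)
  | succ n ih =>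
    rw [pow_succ]
    exact (ih.mul h).mono (by push_cast; linarith)

theorem zpow {c : ℝ} {g : G} (h : σ.WeightedWord q i c g) (r : ℤ) :
    σ.WeightedWord q i (|(r : ℝ)| * c) (g ^ r) := by
  have hr : |(r : ℝ)| = (r.natAbs : ℝ) := by rw [Nat.cast_natAbs, Int.cast_abs]
  rw [hr]
  rcases Int.natAbs_eq r with h' | h'
  · have := h.pow r.natAbs
    rwa [← zpow_natCast, ← h'] at this
  · have := (h.pow r.natAbs).inv
    rwa [← zpow_natCast, ← zpow_neg, ← h'] at this

theorem mem_tail {c : ℝ} {g : G} (h : σ.WeightedWord q i c g) : g ∈ σ.tail i := by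
  induction h with
  | one => exact one_mem _
  | cons j ε c g hj _ _ ih =>
    exact mul_mem (zpow_mem (σ.tail_anti hj (σ.t_mem_tail j)) ε) ih

end WeightedWord

/-- Fix one word for `g`, with `B` its number of letters; since `q ≤ 1`, each letter costs at most
`q ^ (k + 1)`. Thus `B` does not depend on `q`. -/
theorem exists_weightedWord (σ : CentralSequence G) (i k : ℕ) {g : G}
    (hg : g ∈ Subgroup.closure (σ.t '' {l | i ≤ l ∧ k ≤ σ.u l})) :
    ∃ B : ℝ, 0 ≤ B ∧ ∀ q : ℝ, 0 ≤ q → q ≤ 1 → σ.WeightedWord q i (B * q ^ (k + 1)) g := by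
  induction hg using Subgroup.closure_induction with
  | mem x hx =>
    obtain ⟨l, ⟨hil, hkl⟩, rfl⟩ := hx
    refine ⟨1, zero_le_one, fun q h0 h1 => ?_⟩
    rw [one_mul]
    have := WeightedWord.single (σ := σ) (q := q) hil (ε := 1) (Or.inl rfl)
    rw [zpow_one] at this
    exact this.mono (pow_le_pow_of_le_one h0 h1 (by omega))
  | one => exact ⟨0, le_rfl, fun q _ _ => .one _ (by simp)⟩
  | mul x y _ _ hx hy =>
    obtain ⟨B, hB, hx⟩ := hx
    obtain ⟨C, hC, hy⟩ := hy
    exact ⟨B + C, by positivity, fun q h0 h1 => by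
      rw [add_mul]; exact (hx q h0 h1).mul (hy q h0 h1)⟩
  | inv x _ hx =>
    obtain ⟨B, hB, hx⟩ := hx
    exact ⟨B, hB, fun q h0 h1 => (hx q h0 h1).inv⟩

/-- Conjugating by a term of a central sequence increases the cost of later terms by a bounded
multiple. -/
theorem exists_weightedWord_conj (σ : CentralSequence G) (i : ℕ) :
    ∃ B : ℝ, 0 ≤ B ∧ ∀ q : ℝ, 0 ≤ q → q ≤ 1 → ∀ j, i < j → ∀ ε δ : ℤ, (ε = 1 ∨ ε = -1) →
      (δ = 1 ∨ δ = -1) → σ.WeightedWord q (i + 1) (q ^ (σ.u j + 1) * (1 + B * q ^ (σ.u i + 1)))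
        ((σ.t i ^ δ)⁻¹ * σ.t j ^ ε * σ.t i ^ δ) := by
  classical
  have h : ∀ j : ℕ, ∀ ε δ : ℤ, ∃ B : ℝ, 0 ≤ B ∧ ∀ q : ℝ, 0 ≤ q → q ≤ 1 →
      σ.WeightedWord q (i + 1) (B * q ^ (σ.u j + σ.u i + 1 + 1))
        ⁅(σ.t j ^ ε)⁻¹, (σ.t i ^ δ)⁻¹⁆ := by
    intro j ε δ
    apply exists_weightedWord
    -- Weights add under commutators, so this correction is cheaper than `t j` by a factor `O(q ^
    -- (σ.u i + 1))`.
    have h1 : ⁅(σ.t j ^ ε)⁻¹, (σ.t i ^ δ)⁻¹⁆ ∈ γ (σ.u j + σ.u i + 1) :=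
      commutator_lowerCentralSeries_le _ _ (Subgroup.commutator_mem_commutator
        (inv_mem (zpow_mem (σ.t_mem j) ε)) (inv_mem (zpow_mem (σ.t_mem i) δ)))
    refine mem_closure_image_mono (σ.le_closure _ h1) fun l hl => ⟨?_, hl⟩
    exact σ.lt_of_u_lt (lt_of_lt_of_le (by omega) hl)
  choose B hB0 hB using h
  let s : Finset ℤ := {1, -1}
  refine ⟨∑ p ∈ Finset.range σ.N ×ˢ s ×ˢ s, B p.1 p.2.1 p.2.2,
    Finset.sum_nonneg fun p _ => hB0 _ _ _, fun q h0 h1 j hj ε δ hε hδ => ?_⟩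
  set C := ∑ p ∈ Finset.range σ.N ×ˢ s ×ˢ s, B p.1 p.2.1 p.2.2 with hC
  have hC0 : 0 ≤ C := Finset.sum_nonneg fun p _ => hB0 _ _ _
  rcases lt_or_ge j σ.N with hjN | hjN
  · have hle : B j ε δ ≤ C :=
      Finset.single_le_sum (f := fun p : ℕ × ℤ × ℤ => B p.1 p.2.1 p.2.2)
        (fun p _ => hB0 _ _ _) (show (j, ε, δ) ∈ _ by simp [s, hjN, hε, hδ])
    have heq : (σ.t i ^ δ)⁻¹ * σ.t j ^ ε * σ.t i ^ δ =
        σ.t j ^ ε * ⁅(σ.t j ^ ε)⁻¹, (σ.t i ^ δ)⁻¹⁆ := by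
      simp [commutatorElement_def, mul_assoc]
    rw [heq, mul_add, mul_one]
    refine (WeightedWord.single hj hε).mul ((hB j ε δ q h0 h1).mono ?_)
    calc B j ε δ * q ^ (σ.u j + σ.u i + 1 + 1)
        ≤ C * q ^ (σ.u j + σ.u i + 1 + 1) := by gcongr
      _ = q ^ (σ.u j + 1) * (C * q ^ (σ.u i + 1)) := by ring
  · rw [σ.t_eq_one j hjN]
    simp only [one_zpow, mul_one, inv_mul_cancel]
    exact .one _ (by positivity)

/-- Collecting the letters `σ.t i` of a word to the left keeps the cost of the remaining letters
bounded. -/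
theorem exists_weightedWord_collect (σ : CentralSequence G) (i : ℕ) :
    ∃ B : ℝ, 0 ≤ B ∧ ∀ q : ℝ, 0 ≤ q → q ≤ 1 → ∀ (c : ℝ) (g : G), σ.WeightedWord q i c g →
      ∃ e : ℤ, |(e : ℝ)| * q ^ (σ.u i + 1) ≤ c ∧
        σ.WeightedWord q (i + 1) (c * Real.exp (B * c)) ((σ.t i ^ e)⁻¹ * g) := by
  obtain ⟨B, hB0, hB⟩ := σ.exists_weightedWord_conj i
  refine ⟨B, hB0, fun q h0 h1 c g hg => ?_⟩
  set E := 1 + B * q ^ (σ.u i + 1) with hE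
  have hE1 : 0 ≤ E := by positivity
  have conj_one : ∀ δ : ℤ, (δ = 1 ∨ δ = -1) → ∀ c g, σ.WeightedWord q (i + 1) c g →
      σ.WeightedWord q (i + 1) (c * E) ((σ.t i ^ δ)⁻¹ * g * σ.t i ^ δ) := by
    intro δ hδ c g hg
    induction hg with
    | one c hc => rw [mul_one, inv_mul_cancel]; exact .one _ (by positivity)
    | cons j ε c g hj hε _ ih =>
      have := (hB q h0 h1 j hj ε δ hε hδ).mul ih
      rw [← hE, ← add_mul] at this
      convert this using 1
      simp [mul_assoc]
  have conj_pow : ∀ δ : ℤ, (δ = 1 ∨ δ = -1) → ∀ n : ℕ, ∀ c g, σ.WeightedWord q (i + 1) c g →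
      σ.WeightedWord q (i + 1) (c * E ^ n) (((σ.t i ^ δ) ^ n)⁻¹ * g * (σ.t i ^ δ) ^ n) := by
    intro δ hδ n
    induction n with
    | zero => intro c g hg; simpa using hg
    | succ n ih =>
      intro c g hg
      have := conj_one δ hδ _ _ (ih c g hg)
      rw [mul_assoc, ← pow_succ] at this
      convert this using 1
      simp [pow_succ, mul_assoc]
  have conj_zpow : ∀ e : ℤ, ∀ c g, σ.WeightedWord q (i + 1) c g →
      σ.WeightedWord q (i + 1) (c * E ^ e.natAbs) ((σ.t i ^ e)⁻¹ * g * σ.t i ^ e) := by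
    intro e c g hg
    rcases Int.natAbs_eq e with h | h
    · have := conj_pow 1 (Or.inl rfl) e.natAbs c g hg
      rwa [zpow_one, ← zpow_natCast (σ.t i), ← h] at this
    · have := conj_pow (-1) (Or.inr rfl) e.natAbs c g hg
      rwa [← zpow_natCast (σ.t i ^ (-1 : ℤ)), ← zpow_mul, neg_one_mul, ← h] at this
  induction hg with
  | one c hc =>
    exact ⟨0, by simpa using hc, by simpa using .one _ (by positivity)⟩
  | cons j ε c g hj hε hg ih =>
    obtain ⟨e, he, hw⟩ := ih
    have hc0 := hg.nonneg h0
    have hexp : Real.exp (B * c) ≤ Real.exp (B * (q ^ (σ.u j + 1) + c)) := by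
      have : 0 ≤ q ^ (σ.u j + 1) := by positivity
      gcongr; linarith
    rcases hj.eq_or_lt with rfl | hj
    · refine ⟨ε + e, ?_, ?_⟩
      · have : |(ε : ℝ) + e| ≤ 1 + |(e : ℝ)| :=
          (abs_add_le _ _).trans (by rcases hε with rfl | rfl <;> simp)
        push_cast
        calc |(ε : ℝ) + e| * q ^ (σ.u i + 1) ≤ (1 + |(e : ℝ)|) * q ^ (σ.u i + 1) := by gcongr
          _ ≤ _ := by linarith
      · have heq : (σ.t i ^ (ε + e))⁻¹ * (σ.t i ^ ε * g) = (σ.t i ^ e)⁻¹ * g := by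
          simp [zpow_add, mul_assoc]
        rw [heq]
        refine hw.mono (mul_le_mul ?_ hexp (by positivity) (by positivity))
        have : 0 ≤ q ^ (σ.u i + 1) := by positivity
        linarith
    · refine ⟨e, he.trans (by have : 0 ≤ q ^ (σ.u j + 1) := by positivity
                              linarith), ?_⟩
      have h2 := (conj_zpow e _ _ (WeightedWord.single (q := q) hj hε)).mul hw
      have heq : (σ.t i ^ e)⁻¹ * (σ.t j ^ ε * g) =
          (σ.t i ^ e)⁻¹ * σ.t j ^ ε * σ.t i ^ e * ((σ.t i ^ e)⁻¹ * g) := by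
        simp [mul_assoc]
      rw [heq]
      refine h2.mono ?_
      -- Each conjugation multiplies the cost by at most `E`, and `|e| * q ^ (σ.u i + 1) ≤ c` bounds
      -- their number; `1 + x ≤ exp x` makes the product independent of `q`.
      have hEn : E ^ e.natAbs ≤ Real.exp (B * c) := by
        calc E ^ e.natAbs ≤ Real.exp (B * q ^ (σ.u i + 1)) ^ e.natAbs := by
              gcongr; rw [hE, add_comm]; exact Real.add_one_le_exp _
          _ = Real.exp (B * (|(e : ℝ)| * q ^ (σ.u i + 1))) := by
              rw [← Real.exp_nat_mul, Nat.cast_natAbs, Int.cast_abs]; congr 1; ring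
          _ ≤ _ := by gcongr
      rw [add_mul]
      exact add_le_add (mul_le_mul_of_nonneg_left (hEn.trans hexp) (by positivity))
        (mul_le_mul_of_nonneg_left hexp hc0)

/-- An element of the next tail which is a cheap word is a cheap word in the next terms. -/
theorem exists_weightedWord_descend (σ : CentralSequence G) (i : ℕ) (c : ℝ) :
    ∃ c' : ℝ, ∀ q : ℝ, 0 ≤ q → q ≤ 1 → ∀ g ∈ σ.tail (i + 1), σ.WeightedWord q i c g →
      σ.WeightedWord q (i + 1) c' g := by
  obtain ⟨B, hB0, hB⟩ := σ.exists_weightedWord_collect i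
  -- If the order is infinite, `m = 0` and the collected exponent vanishes. Otherwise `t i ^ m` is
  -- replaced by a fixed word in later letters, none costlier than `t i`.
  set m := orderOf (σ.t i : G ⧸ σ.tail (i + 1)) with hm
  have hmem : ∀ r : ℤ, σ.t i ^ r ∈ σ.tail (i + 1) ↔ (m : ℤ) ∣ r := by
    intro r
    rw [hm, orderOf_dvd_iff_zpow_eq_one, ← QuotientGroup.mk_zpow, QuotientGroup.eq_one_iff]
  have hcl : σ.t i ^ (m : ℤ) ∈ Subgroup.closure (σ.t '' {l | i + 1 ≤ l ∧ σ.u i ≤ σ.u l}) :=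
    mem_closure_image_mono ((hmem m).2 dvd_rfl) fun l hl =>
      ⟨hl, σ.mono ((Nat.le_succ i).trans hl)⟩
  obtain ⟨A, hA0, hA⟩ := σ.exists_weightedWord _ _ hcl
  refine ⟨A * c + c * Real.exp (B * c), fun q h0 h1 g hg hw => ?_⟩
  have hc0 := hw.nonneg h0
  obtain ⟨e, he, hw'⟩ := hB q h0 h1 c g hw
  have htail : (σ.t i ^ e)⁻¹ * g ∈ σ.tail (i + 1) := hw'.mem_tail
  have hte : σ.t i ^ e ∈ σ.tail (i + 1) := by
    have := mul_mem hg (inv_mem htail)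
    simpa using this
  obtain ⟨f, hf, hfe⟩ : ∃ f : ℤ, e = m * f ∧ |(f : ℝ)| ≤ |(e : ℝ)| := by
    obtain ⟨f, hf⟩ := (hmem e).1 hte
    rcases Nat.eq_zero_or_pos m with h | h
    · exact ⟨0, by simp [hf, h], by simp⟩
    · refine ⟨f, hf, ?_⟩
      rw [hf]; push_cast; rw [abs_mul, Nat.abs_cast]
      exact le_mul_of_one_le_left (abs_nonneg _) (by exact_mod_cast h)
  have h3 := ((hA q h0 h1).zpow f).mul hw'
  rw [← zpow_mul, ← hf, mul_inv_cancel_left] at h3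
  refine h3.mono (add_le_add ?_ le_rfl)
  calc |(f : ℝ)| * (A * q ^ (σ.u i + 1)) = A * (|(f : ℝ)| * q ^ (σ.u i + 1)) := by ring
    _ ≤ A * (|(e : ℝ)| * q ^ (σ.u i + 1)) := by gcongr
    _ ≤ A * c := by gcongr

/-- With `q = 1 / n`, each of the `n` factors from `S` costs `O(1 / n)`, so the total is bounded at
`i = 0`; each descent keeps it bounded uniformly in `n`. -/
theorem exists_weightedWord_of_mem_pow (σ : CentralSequence G) {S : Set G} (hfin : S.Finite)
    (i : ℕ) : ∃ c : ℝ, ∀ n : ℕ, 1 ≤ n → ∀ g ∈ σ.tail i, g ∈ S ^ n →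
      σ.WeightedWord (1 / n : ℝ) i c g := by
  have hq : ∀ n : ℕ, 1 ≤ n → (1 / n : ℝ) ≤ 1 := fun n hn => by
    rw [div_le_one (by positivity)]; exact_mod_cast hn
  induction i with
  | zero =>
    have h : ∀ g : G, ∃ B : ℝ, 0 ≤ B ∧ ∀ q : ℝ, 0 ≤ q → q ≤ 1 →
        σ.WeightedWord q 0 (B * q ^ (0 + 1)) g := by
      intro g
      apply exists_weightedWord
      have : g ∈ σ.tail 0 := σ.tail_zero ▸ Subgroup.mem_top g
      exact mem_closure_image_mono this fun l _ => ⟨Nat.zero_le _, Nat.zero_le _⟩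
    choose B hB0 hB using h
    refine ⟨∑ s ∈ hfin.toFinset, B s, fun n hn g _ hg => ?_⟩
    set C := ∑ s ∈ hfin.toFinset, B s with hC
    suffices ∀ k : ℕ, ∀ g ∈ S ^ k, σ.WeightedWord (1 / n : ℝ) 0 (k * (C * (1 / n))) g by
      refine (this n g hg).mono (le_of_eq ?_)
      have : (n : ℝ) ≠ 0 := by positivity
      field_simp
    intro k
    induction k with
    | zero => intro g hg; rw [pow_zero, Set.mem_one] at hg; subst hg; exact .one _ (by simp)
    | succ k ih =>
      intro g hg
      rw [pow_succ] at hg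
      obtain ⟨a, ha, s, hs, rfl⟩ := hg
      refine ((ih a ha).mul (hB s _ (by positivity) (hq n hn))).mono ?_
      have : B s ≤ C := Finset.single_le_sum (f := B) (fun _ _ => hB0 _) (hfin.mem_toFinset.2 hs)
      have h2 : B s * (1 / n : ℝ) ≤ C * (1 / n) := by gcongr
      push_cast
      rw [pow_one]
      linarith
  | succ i ih =>
    obtain ⟨c, hc⟩ := ih
    obtain ⟨c', hc'⟩ := σ.exists_weightedWord_descend i c
    exact ⟨c', fun n hn g hg hgS => hc' _ (by positivity) (hq n hn) g hg
      (hc n hn g (σ.tail_anti (Nat.le_succ i) hg) hgS)⟩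

/-- The distortion bound: an element of length at most `n` of a tail has exponent
`O(n ^ (σ.u i + 1))` along the first term. -/
theorem exists_zpow_of_mem_pow (σ : CentralSequence G) {S : Set G} (hfin : S.Finite) (i : ℕ) :
    ∃ C : ℕ, ∀ n : ℕ, 1 ≤ n → ∀ g ∈ σ.tail i, g ∈ S ^ n →
      ∃ e : ℤ, |e| ≤ (C * n ^ (σ.u i + 1) : ℕ) ∧ (σ.t i ^ e : G) = (g : G ⧸ σ.tail (i + 1)) := by
  obtain ⟨c, hc⟩ := σ.exists_weightedWord_of_mem_pow hfin i
  obtain ⟨B, hB0, hB⟩ := σ.exists_weightedWord_collect i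
  refine ⟨⌈c⌉₊, fun n hn g hg hgS => ?_⟩
  have hn0 : (0 : ℝ) < n := by positivity
  obtain ⟨e, he, hw⟩ := hB (1 / n) (by positivity)
    (by rw [div_le_one hn0]; exact_mod_cast hn) c g (hc n hn g hg hgS)
  refine ⟨e, ?_, QuotientGroup.eq.2 hw.mem_tail⟩
  · rw [one_div, inv_pow, ← div_eq_mul_inv, div_le_iff₀ (by positivity)] at he
    have : |(e : ℝ)| ≤ ⌈c⌉₊ * (n : ℝ) ^ (σ.u i + 1) :=
      he.trans (by gcongr; exact Nat.le_ceil c)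
    exact_mod_cast this

end CentralSequence

end Distortion

/-! ### Covering balls in nilpotent groups. -/

section Covering

open scoped commutatorElement

namespace CentralSequence

variable {G : Type*} [Group G]

/-- Up to boundedly many left translations and an error of length `O(m)`, every element of length
at most `R * m` lies in a given tail of a central sequence. The constant in `O(m)` does not depend
on `R`. -/
theorem exists_cover_tail (σ : CentralSequence G) {S : Set G} (hfin : S.Finite) (hone : (1 : G) ∈ S)
    (hsymm : S⁻¹ = S) (hgen : Subgroup.closure S = ⊤) (i : ℕ) :
    ∃ D : ℕ, ∀ R : ℕ, ∃ L R' : ℕ, ∀ m : ℕ, 1 ≤ m → ∃ Y : Finset G, Y.card ≤ L ∧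
      ∀ g ∈ S ^ (R * m), ∃ y ∈ Y, ∃ b ∈ S ^ (D * m), ∃ h ∈ σ.tail i,
        h ∈ S ^ (R' * m) ∧ g = y * b * h := by
  classical
  induction i with
  | zero =>
    refine ⟨0, fun R => ⟨1, R, fun m _ => ⟨{1}, by simp, fun g hg => ?_⟩⟩⟩
    exact ⟨1, by simp, 1, by simp, g, σ.tail_zero ▸ Subgroup.mem_top g, hg, by simp⟩
  | succ i ih =>
    obtain ⟨D, hD⟩ := ih
    obtain ⟨E, hE⟩ := exists_mem_pow_zpow hone hsymm hgen (σ.u i) (σ.t_mem i)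
    obtain ⟨C, hC⟩ := σ.exists_zpow_of_mem_pow hfin i
    refine ⟨D + E, fun R => ?_⟩
    obtain ⟨L, R', hR⟩ := hD R
    -- `Q` bounds the quotient of the exponent by `m ^ (σ.u i + 1)`. Using `R' + 1` makes the length
    -- positive, as the distortion bound requires.
    set Q : ℕ := C * (R' + 1) ^ (σ.u i + 1) with hQ
    refine ⟨L * (2 * Q + 1), E + D + E * Q + D + (R' + 1), fun m hm => ?_⟩
    obtain ⟨Y, hYc, hY⟩ := hR m hm
    have hm0 : (0 : ℤ) < (m : ℤ) ^ (σ.u i + 1) := by positivity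
    have hroot : ∀ r : ℤ, |r| ≤ (m : ℤ) ^ (σ.u i + 1) → ∃ b ∈ S ^ (E * m),
        (b : G ⧸ σ.tail (i + 1)) = (σ.t i : G ⧸ σ.tail (i + 1)) ^ r := by
      intro r hr
      obtain ⟨b, hb, hb'⟩ := hE m hm r hr
      exact ⟨b, hb, QuotientGroup.eq.2 (σ.lowerCentralSeries_le_tail i hb')⟩
    have hcen : ∀ g : G, Commute (σ.t i : G ⧸ σ.tail (i + 1)) (g : G ⧸ σ.tail (i + 1)) := fun g =>
      commutatorElement_mem_iff_commute.1 (σ.lowerCentralSeries_le_tail i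
        (Subgroup.commutator_mem_commutator (σ.t_mem i) (Subgroup.mem_top g)))
    obtain ⟨d, hd, hdt⟩ := hroot ((m : ℤ) ^ (σ.u i + 1)) (abs_of_pos hm0).le
    refine ⟨(Y ×ˢ Finset.Icc (-(Q : ℤ)) Q).image fun p => p.1 * d ^ p.2, ?_, fun g hg => ?_⟩
    · refine Finset.card_image_le.trans ?_
      rw [Finset.card_product, Int.card_Icc]
      exact Nat.mul_le_mul hYc (by omega)
    obtain ⟨y, hy, b, hb, h, hh, hhS, rfl⟩ := hY g hg
    have hhS' : h ∈ S ^ ((R' + 1) * m) :=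
      mem_pow_of_le hone (Nat.mul_le_mul_right m (Nat.le_succ R')) hhS
    obtain ⟨e, he, het⟩ := hC ((R' + 1) * m)
      (Nat.one_le_iff_ne_zero.2 (Nat.mul_ne_zero (by omega) (by omega))) h hh hhS'
    set M : ℤ := (m : ℤ) ^ (σ.u i + 1) with hM
    have he' : |e| ≤ Q * M := by
      refine he.trans (le_of_eq ?_)
      rw [hQ, hM, mul_pow]; push_cast; ring
    have hq : |e / M| ≤ Q := by
      rw [abs_le] at he' ⊢
      constructor
      · rw [Int.le_ediv_iff_mul_le hm0]; linarith [he'.1]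
      · exact Int.ediv_le_of_le_mul hm0 he'.2
    have hr0 := Int.emod_nonneg e hm0.ne'
    have hrm := Int.emod_lt_of_pos e hm0
    obtain ⟨c, hc, hct⟩ := hroot (e % M) (by rw [abs_of_nonneg hr0]; exact hrm.le)
    -- The quotient part `d ^ (e / M)` joins the translate and the remainder `c` joins the error.
    -- Moving `d ^ (e / M)` left past `b` is harmless because `t i` is central modulo the next tail.
    refine ⟨y * d ^ (e / M), Finset.mem_image.2 ⟨(y, e / M), ?_, rfl⟩, b * c, ?_,
      c⁻¹ * b⁻¹ * (d ^ (e / M))⁻¹ * b * h, ?_, ?_, by group⟩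
    · simpa [hy] using abs_le.1 hq
    · rw [add_mul]; exact mul_mem_pow_add hb hc
    · rw [← QuotientGroup.eq_one_iff]
      simp only [QuotientGroup.mk_mul, QuotientGroup.mk_inv, QuotientGroup.mk_zpow] at het ⊢
      rw [hct, hdt, ← het, ← zpow_mul]
      rw [mul_assoc, mul_assoc, mul_assoc, ← mul_assoc (_⁻¹ : G ⧸ σ.tail (i + 1)) (b : G ⧸ σ.tail (i + 1)),
        (((hcen b).zpow_left _).inv_left).eq, mul_assoc, inv_mul_cancel_left]
      rw [← zpow_neg, ← zpow_neg, ← zpow_add, ← zpow_add, ← add_assoc]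
      have : -(e % M) + -(M * (e / M)) + e = 0 := by linarith [Int.mul_ediv_add_emod e M]
      rw [this, zpow_zero]
    · have := mul_mem_pow_add (mul_mem_pow_add (mul_mem_pow_add (mul_mem_pow_add
        (inv_mem_pow hsymm hc) (inv_mem_pow hsymm hb))
        (inv_mem_pow hsymm (zpow_mem_pow hone hsymm hd hq))) hb) hhS'
      convert this using 2
      ring

end CentralSequence

/-- Balls of comparable radii in a finitely generated nilpotent group cover each other by boundedly
many translates. -/
theorem exists_cover_of_isNilpotent {G : Type*} [Group G] [Group.IsNilpotent G] {S : Set G}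
    (hfin : S.Finite) (hone : (1 : G) ∈ S) (hsymm : S⁻¹ = S) (hgen : Subgroup.closure S = ⊤) :
    ∃ D : ℕ, ∀ R : ℕ, ∃ L : ℕ, ∀ m : ℕ, 1 ≤ m → ∃ Y : Finset G, Y.card ≤ L ∧
      S ^ (R * m) ⊆ (Y : Set G) * S ^ (D * m) := by
  have : Group.FG G := Group.fg_iff.2 ⟨S, hgen, hfin⟩
  obtain ⟨σ⟩ := nonempty_centralSequence (G := G)
  obtain ⟨D, hD⟩ := σ.exists_cover_tail hfin hone hsymm hgen σ.N
  refine ⟨D, fun R => ?_⟩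
  obtain ⟨L, R', hR⟩ := hD R
  refine ⟨L, fun m hm => ?_⟩
  obtain ⟨Y, hYc, hY⟩ := hR m hm
  refine ⟨Y, hYc, fun g hg => ?_⟩
  obtain ⟨y, hy, b, hb, h, hh, -, rfl⟩ := hY g hg
  rw [σ.tail_N, Subgroup.mem_bot] at hh
  exact ⟨y, hy, b, hb, by simp [hh]⟩

/-! ### Passage to virtually nilpotent groups. -/

/-- A finite index subgroup `H` has a finite subset `U` such that every product of `n` generators of
the whole group is a product of `n` elements of `U`, up to a finite set of right factors. -/
theorem exists_finite_pow_subset_mul {Γ : Type*} [Group Γ] (H : Subgroup Γ) [H.FiniteIndex]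
    {S : Set Γ} (hfin : S.Finite) :
    ∃ (U : Set H) (A : Set Γ), U.Finite ∧ A.Finite ∧
      ∀ n : ℕ, ∀ g ∈ S ^ n, ∃ x ∈ U ^ n, ∃ a ∈ A, g = x * a := by
  set A : Set Γ := insert 1 (Set.range fun p : Γ ⧸ H => p.out⁻¹) with hA
  have hAfin : A.Finite := (Set.finite_range _).insert 1
  have hAmem : ∀ g : Γ, ∃ a ∈ A, g * a⁻¹ ∈ H := by
    intro g
    refine ⟨_, Or.inr ⟨((g⁻¹ : Γ) : Γ ⧸ H), rfl⟩, ?_⟩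
    have := QuotientGroup.eq.1 (QuotientGroup.out_eq' ((g⁻¹ : Γ) : Γ ⧸ H)).symm
    rwa [inv_inv] at this ⊢
  -- Schreier rewriting: `a * s = (a * s * a'⁻¹) * a'` with the bracket in `H`.
  refine ⟨Subtype.val ⁻¹' (A * S * A⁻¹), A,
    ((hAfin.mul hfin).mul hAfin.inv).preimage Subtype.val_injective.injOn, hAfin, fun n => ?_⟩
  induction n with
  | zero =>
    intro g hg
    rw [pow_zero, Set.mem_one] at hg
    exact ⟨1, by simp, 1, Set.mem_insert _ _, by simp [hg]⟩
  | succ n ih =>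
    intro g hg
    rw [pow_succ] at hg
    obtain ⟨g, hg, s, hs, rfl⟩ := hg
    obtain ⟨x, hx, a, ha, rfl⟩ := ih g hg
    obtain ⟨a', ha', hmem⟩ := hAmem (a * s)
    refine ⟨x * ⟨_, hmem⟩, ?_, a', ha', by simp [mul_assoc]⟩
    rw [pow_succ]
    exact Set.mul_mem_mul hx (Set.mul_mem_mul (Set.mul_mem_mul ha hs) (Set.inv_mem_inv.2 ha'))

theorem exists_subset_pow {G : Type*} [Group G] {S : Set G} (hone : (1 : G) ∈ S)
    (hsymm : S⁻¹ = S) (hgen : Subgroup.closure S = ⊤) {A : Set G} (hA : A.Finite) :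
    ∃ n, A ⊆ S ^ n := by
  choose l hl using exists_mem_pow hsymm hgen
  refine ⟨∑ a ∈ hA.toFinset, l a, fun a ha => mem_pow_of_le hone ?_ (hl a)⟩
  exact Finset.single_le_sum (f := l) (fun _ _ => Nat.zero_le _) (hA.mem_toFinset.2 ha)

/-- The cover is taken in `H` for a symmetric generating set `W` containing the Schreier elements.
Returning to `S` multiplies lengths by `E`; the right factor from `A` costs `F ≤ F * m`. -/
theorem exists_cover_of_isVirtuallyNilpotent {Γ : Type*} [Group Γ]
    (hΓ : Group.IsVirtuallyNilpotent Γ) {S : Set Γ} (hfin : S.Finite) (hone : (1 : Γ) ∈ S)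
    (hsymm : S⁻¹ = S) (hgen : Subgroup.closure S = ⊤) :
    ∃ D : ℕ, ∀ R : ℕ, ∃ L : ℕ, ∀ m : ℕ, 1 ≤ m → ∃ Y : Finset Γ, Y.card ≤ L ∧
      S ^ (R * m) ⊆ (Y : Set Γ) * S ^ (D * m) := by
  classical
  have : Group.FG Γ := Group.fg_iff.2 ⟨S, hgen, hfin⟩
  obtain ⟨H, hH, hHi⟩ := hΓ
  obtain ⟨V, hV, hVfin⟩ := (Group.fg_iff (G := H)).1 inferInstance
  obtain ⟨U, A, hU, hA, hUA⟩ := exists_finite_pow_subset_mul H hfin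
  set W₀ : Set H := insert 1 (U ∪ V) with hW₀
  have hW₀fin : W₀.Finite := (hU.union hVfin).insert 1
  set W : Set H := W₀ ∪ W₀⁻¹ with hW
  have hWfin : W.Finite := hW₀fin.union hW₀fin.inv
  have hUW : U ⊆ W := fun x hx => Or.inl (Or.inr (Or.inl hx))
  have hWgen : Subgroup.closure W = ⊤ := by
    rw [eq_top_iff, ← hV]
    exact Subgroup.closure_mono fun x hx => Or.inl (Or.inr (Or.inr hx))
  obtain ⟨D, hD⟩ := exists_cover_of_isNilpotent hWfin (Or.inl (Set.mem_insert _ _))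
    (by rw [hW, Set.union_inv, inv_inv, Set.union_comm]) hWgen
  obtain ⟨E, hE⟩ := exists_subset_pow hone hsymm hgen (hWfin.image Subtype.val)
  obtain ⟨F, hF⟩ := exists_subset_pow hone hsymm hgen hA
  have hWpow : ∀ n : ℕ, ∀ x ∈ W ^ n, (x : Γ) ∈ S ^ (E * n) := by
    intro n x hx
    have h1 : (x : Γ) ∈ H.subtype '' (W ^ n) := ⟨x, hx, rfl⟩
    rw [Set.image_pow] at h1
    rw [pow_mul]
    exact Set.pow_subset_pow_left hE h1
  refine ⟨E * D + F, fun R => ?_⟩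
  obtain ⟨L, hL⟩ := hD R
  refine ⟨L, fun m hm => ?_⟩
  obtain ⟨Y, hYc, hY⟩ := hL m hm
  refine ⟨Y.image Subtype.val, Finset.card_image_le.trans hYc, fun g hg => ?_⟩
  obtain ⟨x, hx, a, ha, rfl⟩ := hUA _ g hg
  obtain ⟨y, hy, b, hb, rfl⟩ := hY (Set.pow_subset_pow_left hUW hx)
  refine ⟨y, by simpa using hy, b * a, ?_, by simp [mul_assoc]⟩
  refine mem_pow_of_le hone ?_ (mul_mem_pow_add (hWpow _ b hb) (hF ha))
  nlinarith [Nat.mul_le_mul_left F hm]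

end Covering

theorem wordBall_eq_pow {Γ : Type*} [Group Γ] {S : Set Γ} (hone : (1 : Γ) ∈ S) (n : ℕ) :
    wordBall S n = S ^ n := by
  ext g
  constructor
  · intro hg
    rw [wordBall, Set.mem_ofPred_eq, wordLength] at hg
    rcases Set.eq_empty_or_nonempty {k : ℕ∞ | ∃ n : ℕ, k = n ∧ g ∈ S ^ n} with h | h
    · rw [h, sInf_empty] at hg
      exact absurd hg (by simp)
    · obtain ⟨k, hk, hgk⟩ := csInf_mem h
      rw [hk] at hg
      exact mem_pow_of_le hone (by exact_mod_cast hg) hgk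
  · exact fun hg => sInf_le (show _ ∈ {k : ℕ∞ | ∃ n : ℕ, k = n ∧ g ∈ S ^ n} from ⟨n, rfl, hg⟩)

theorem mainTheorem5 {Γ : Type*} [Group Γ] [Group.FG Γ] (hΓ : Group.IsVirtuallyNilpotent Γ)
    (S : Set Γ) (hfin : S.Finite) (hsymm : S⁻¹ = S) (hgen : Subgroup.closure S = ⊤)
    (hone : (1 : Γ) ∈ S) (R₀ θ : ℝ) (hR₀ : 1 ≤ R₀) (hθ : 0 < θ) (hθ' : θ ≤ 1) :
    ∃ L h₀ : ℕ, 0 < L ∧ 0 < h₀ ∧ ∀ h : ℕ, h₀ ≤ h →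
      ∃ Y : Finset Γ, Y.card ≤ L ∧
        wordBall S ⌊R₀ * h⌋₊ ⊆ (Y : Set Γ) * wordBall S ⌊θ * h⌋₊ ∧
        S ^ ⌊R₀ * h⌋₊ ⊆ (Y : Set Γ) * S ^ ⌊θ * h⌋₊ := by
  simp only [wordBall_eq_pow hone, and_self]
  obtain ⟨D, hD⟩ := exists_cover_of_isVirtuallyNilpotent hΓ hfin hone hsymm hgen
  -- With `m = k / (D + 1) ≥ 1`, one has `θ * h < k + 1 ≤ (D + 1) * (m + 1) ≤ 2 * (D + 1) * m`,
  -- which dictates this `R`. The threshold on `h` serves to give `m ≥ 1`.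
  obtain ⟨L, hL⟩ := hD ⌈R₀ * (2 * (D + 1)) / θ⌉₊
  refine ⟨L + 1, ⌈(D + 1) / θ⌉₊ + 1, Nat.succ_pos _, Nat.succ_pos _, fun h hh => ?_⟩
  set k := ⌊θ * h⌋₊ with hk
  have hDk : D + 1 ≤ k := by
    refine Nat.le_floor ?_
    have h1 : ((D : ℝ) + 1) / θ ≤ h :=
      (Nat.le_ceil _).trans (by exact_mod_cast (Nat.le_succ _).trans hh)
    rw [div_le_iff₀ hθ] at h1
    push_cast; linarith
  set m := k / (D + 1) with hm
  have hm1 : 1 ≤ m := (Nat.one_le_div_iff (Nat.succ_pos D)).2 hDk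
  have hmk : (D + 1) * m ≤ k := Nat.mul_div_le k (D + 1)
  have hkm : k < (D + 1) * (m + 1) := Nat.lt_mul_div_succ k (Nat.succ_pos D)
  obtain ⟨Y, hYc, hY⟩ := hL m hm1
  refine ⟨Y, hYc.trans (Nat.le_succ L), fun g hg => ?_⟩
  have hR : ⌊R₀ * h⌋₊ ≤ ⌈R₀ * (2 * (D + 1)) / θ⌉₊ * m := by
    have h1 : θ * h < 2 * (D + 1) * m := by
      have h2 : k + 1 ≤ 2 * (D + 1) * m := by nlinarith
      calc θ * h < k + 1 := Nat.lt_floor_add_one _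
        _ ≤ 2 * (D + 1) * m := by exact_mod_cast h2
    have h3 : R₀ * h ≤ R₀ * (2 * (D + 1)) / θ * m := by
      rw [div_mul_eq_mul_div, le_div_iff₀ hθ]
      nlinarith
    have h4 : R₀ * h ≤ ((⌈R₀ * (2 * (D + 1)) / θ⌉₊ * m : ℕ) : ℝ) := by
      refine h3.trans ?_
      push_cast
      gcongr
      exact Nat.le_ceil _
    exact Nat.floor_le_of_le h4
  obtain ⟨y, hy, b, hb, rfl⟩ := hY (mem_pow_of_le hone hR hg)
  exact ⟨y, hy, b, mem_pow_of_le hone (by nlinarith) hb, rfl⟩
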